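/- Let $\Gamma=(V,E)$ be a countable, undirected graph without loops or multiple edges, and let $A_\Gamma^+=\langle a_v,\ v\in V \mid a_va_w=a_wa_v \text{ whenever } (v,w)\in E\rangle^+$ be its right-angled Artin monoid (the graph product over $\Gamma$ of copies of $\mathbb{N}$). Then $A_\Gamma^+$ is admissible if and only if it admits a generalised scale. Here the following terminology is used for a monoid $S$. It is \emph{right LCM} if it is left cancellative and, for all $s,t\in S$, $sS\cap tS$ is either empty or of the form $rS$ with $r\in S$. Write $s\perp t$ if $sS\cap tS=\emptyset$. A finite set $F\subset S$ is a \emph{foundation set} if for every $s\in S$ there is $f\in F$ with $f\not\perp s$, and a set $F\subset S$ is \emph{accurate} if $f\perp f'$ for all distinct $f,f'\in F$. Let $S^*$ be the group of invertible elements, let $S_c=\{a\in S : a\not\perp s \text{ for all } s\in S\}$ be the core, let $s\sim t$ mean that $sa=tb$ for some $a,b\in S_c$ (an equivalence relation if $S$ is right LCM), and let $S_{ci}$ be the set of all $s\in S\setminus S_c$ such that $s=ta$ with $t\in S$ and $a\in S_c$ implies $a\in S^*$. Let $\mathbb{N}^\times$ be the multiplicative monoid of positive integers. A \emph{generalised scale}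 on $S$ is a nontrivial monoid homomorphism $N\colon S\to\mathbb{N}^\times$ such that for every $n\in N(S)$ the set $N^{-1}(n)/_\sim$ has exactly $n$ elements and every minimal complete set of representatives for $N^{-1}(n)/_\sim$ is an accurate foundation set for $S$. The monoid $S$ is \emph{admissible} if \begin{enumerate} \item $S$ is right LCM; \item $S$ is core factorable: $S=(S_{ci}\cup\{1\})\,S_c$; \item $S_{ci}\subset S$ is $\cap$-closed: if $s,t\in S_{ci}$ and $sS\cap tS=rS$ with $r\in S$, then $r\in S_{ci}$; \item $S$ admits a generalised scale $N$ such that the commutative monoid $N(S)\subset\mathbb{N}^\times$ is freely generated by its irreducible elements, i.e. every element of $N(S)$ is the product of exactly one finite multiset of irreducible elements of the monoid $N(S)$. \end{enumerate} -/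

import Mathlib

namespace LCMSemigroup

variable {S : Type*} [Monoid S]

/-- The principal right ideal `sS`. -/
def principal (s : S) : Set S := Set.range (fun x => s * x)

/-- A left cancellative monoid is right LCM if the intersection of two principal right ideals is
either empty or a principal right ideal. -/
def IsRightLCM (S : Type*) [Monoid S] : Prop :=
  IsLeftCancelMul S ∧
    ∀ s t : S, principal s ∩ principal t = ∅ ∨ ∃ r : S, principal s ∩ principal t = principal r

/-- Orthogonality `s ⊥ t`. -/
def Orthogonal (s t : S) : Prop := principal s ∩ principal t = ∅

/-- Foundation sets (finite by definition). -/
def IsFoundationSet (F : Set S) : Prop :=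
  F.Finite ∧ ∀ s : S, ∃ f ∈ F, ¬ Orthogonal f s

/-- Accurate subsets: distinct elements are orthogonal. -/
def IsAccurate (F : Set S) : Prop :=
  ∀ f ∈ F, ∀ f' ∈ F, f ≠ f' → Orthogonal f f'

/-- The core subsemigroup `S_c`. -/
def core (S : Type*) [Monoid S] : Set S := {a | ∀ s : S, ¬ Orthogonal a s}

/-- The core relation `s ∼ t`. -/
def CoreRel (s t : S) : Prop := ∃ a ∈ core S, ∃ b ∈ core S, s * a = t * b

/-- The core irreducible elements `S_ci`. -/
def coreIrreducible (S : Type*) [Monoid S] : Set S :=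
  {s | s ∉ core S ∧ ∀ t : S, ∀ a ∈ core S, s = t * a → IsUnit a}

/-- `S = S_ci^1 S_c`, where `S_ci^1` is `S_ci` with the identity adjoined. -/
def IsCoreFactorable (S : Type*) [Monoid S] : Prop :=
  ∀ s : S, ∃ t ∈ coreIrreducible S ∪ {1}, ∃ a ∈ core S, s = t * a

/-- `S_ci ⊂ S` is `∩`-closed. -/
def IsCapClosed (S : Type*) [Monoid S] : Prop :=
  ∀ s ∈ coreIrreducible S, ∀ t ∈ coreIrreducible S, ∀ r : S,
    principal s ∩ principal t = principal r → r ∈ coreIrreducible S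

/-- The class of `s` for the core relation. -/
def coreClass (s : S) : Set S := {t | CoreRel s t}

/-- `T` is a minimal complete set of representatives for `A` modulo the core relation. -/
def IsTransversal (A T : Set S) : Prop :=
  T ⊆ A ∧ ∀ s ∈ A, ∃! t, t ∈ T ∧ CoreRel s t

/-- The fibre `N⁻¹(n)`. -/
def fibre (N : S →* ℕ+) (n : ℕ+) : Set S := {s | N s = n}

/-- A nontrivial homomorphism `N` to the multiplicative monoid of positive integers is a
generalised scale if, for every value `n` of `N`, the set `N⁻¹(n)` has exactly `n` classes and
each of its minimal complete sets of representatives is an accurate foundation set. -/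
def IsGeneralisedScale (N : S →* ℕ+) : Prop :=
  N ≠ 1 ∧ ∀ n ∈ Set.range N,
    (coreClass '' fibre N n).encard = ((n : ℕ) : ℕ∞) ∧
      ∀ T : Set S, IsTransversal (fibre N n) T → IsFoundationSet T ∧ IsAccurate T

/-- A commutative monoid is freely generated by its irreducible elements: every element is the
product of exactly one finite multiset of irreducible elements. -/
def IsFreelyGeneratedByIrreducibles (M : Type*) [CommMonoid M] : Prop :=
  Function.Bijective (fun F : Multiset {x : M // Irreducible x} => (F.map Subtype.val).prod)

/-- Admissible right LCM semigroups. -/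
def IsAdmissible (S : Type*) [Monoid S] : Prop :=
  IsRightLCM S ∧ IsCoreFactorable S ∧ IsCapClosed S ∧
    ∃ N : S →* ℕ+, IsGeneralisedScale N ∧
      IsFreelyGeneratedByIrreducibles (MonoidHom.mrange N)

/-- On a right LCM monoid, the core relation is an equivalence relation. -/
theorem coreRel_equivalence (h : IsRightLCM S) : Equivalence (CoreRel (S := S)) := by
  obtain ⟨hc, hl⟩ := h
  have key : ∀ a ∈ core S, ∀ s : S, ∃ x y : S, a * x = s * y := by
    intro a ha s
    obtain ⟨z, ⟨x, hx⟩, y, hy⟩ := Set.nonempty_iff_ne_empty.2 (ha s)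
    exact ⟨x, y, hx.trans hy.symm⟩
  have mk : ∀ a : S, (∀ s : S, ∃ x y : S, a * x = s * y) → a ∈ core S := by
    intro a ha s he
    obtain ⟨x, y, hxy⟩ := ha s
    have : a * x ∈ principal a ∩ principal s := ⟨⟨x, rfl⟩, y, hxy.symm⟩
    rw [show principal a ∩ principal s = ∅ from he] at this
    exact this
  have one : (1 : S) ∈ core S := mk 1 fun s => ⟨s, 1, by simp⟩
  have mul : ∀ a ∈ core S, ∀ b ∈ core S, a * b ∈ core S := by
    intro a ha b hb
    refine mk _ fun s => ?_
    obtain ⟨x, y, hxy⟩ := key a ha s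
    obtain ⟨u, v, huv⟩ := key b hb x
    exact ⟨u, y * v, by rw [mul_assoc, huv, ← mul_assoc, hxy, mul_assoc]⟩
  -- right quotients of a common multiple of two core elements are again in the core
  have quo : ∀ b ∈ core S, ∀ c ∈ core S, ∀ x y : S, b * x = c * y →
      principal b ∩ principal c = principal (b * x) → x ∈ core S := by
    intro b hb c hc' x y hxy he
    refine mk _ fun s => ?_
    obtain ⟨p, q, hpq⟩ := key c hc' (b * s)
    have hm : c * p ∈ principal b ∩ principal c :=
      ⟨⟨s * q, by simp only [hpq, mul_assoc]⟩, p, rfl⟩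
    rw [he] at hm
    obtain ⟨u, hu⟩ := hm
    refine ⟨u, q, mul_left_cancel (a := b) ?_⟩
    rw [← mul_assoc, ← mul_assoc, ← hpq]
    exact hu
  refine ⟨fun s => ⟨1, one, 1, one, rfl⟩, ?_, ?_⟩
  · rintro s t ⟨a, ha, b, hb, hab⟩
    exact ⟨b, hb, a, ha, hab.symm⟩
  · rintro s t u ⟨a, ha, b, hb, hab⟩ ⟨c, hc', d, hd, hcd⟩
    obtain he | ⟨r, hr⟩ := hl b c
    · exact absurd he (hb c)
    · have hm : r ∈ principal b ∩ principal c := by rw [hr]; exact ⟨1, mul_one r⟩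
      obtain ⟨⟨x, hx⟩, y, hy⟩ := hm
      simp only at hx hy
      have hxy : b * x = c * y := hx.trans hy.symm
      have hx' : x ∈ core S := quo b hb c hc' x y hxy (by rw [hx, hr])
      have hy' : y ∈ core S :=
        quo c hc' b hb y x hxy.symm (by rw [hy, Set.inter_comm, hr])
      refine ⟨a * x, mul a ha x hx', d * y, mul d hd y hy', ?_⟩
      rw [← mul_assoc, hab, mul_assoc, hxy, ← mul_assoc, hcd, mul_assoc]

/-- The commutation relations `a_v a_w = a_w a_v` for adjacent `v`, `w`. -/
def artinRel {V : Type*} (Γ : SimpleGraph V) (x y : FreeMonoid V) : Prop :=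
  ∃ v w : V, Γ.Adj v w ∧ x = FreeMonoid.of v * FreeMonoid.of w ∧
    y = FreeMonoid.of w * FreeMonoid.of v

/-- The right-angled Artin monoid `A_Γ^+`, i.e. the graph product of copies of `ℕ` over `Γ`: one
free generator for each vertex, with adjacent generators commuting. -/
abbrev RightAngledArtinMonoid {V : Type*} (Γ : SimpleGraph V) : Type _ :=
  PresentedMonoid (artinRel Γ)

end LCMSemigroup

namespace LCMSemigroup

/-! ### Core relation and generalised scales on a general monoid. -/

section General

variable {S : Type*} [Monoid S]

/-! A generalised scale `N` determines the graph. Elements of equal value are either core-equivalent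
or orthogonal, and the core is exactly the set of elements of value 1. A core letter is adjacent to
every other vertex, so the core is central. The key lemma `adj_iff_apply_gen_ne` shows by induction
on the value that a vertex of value different from 1 is adjacent precisely to the vertices of a
different value.

Hence non-adjacency is transitive, `Γ` is complete multipartite, and the monoid embeds in a product
of free monoids, one for each class (`eq_of_proj_eq`). This gives cancellation and LCMs. Splitting
off the central core letters gives core factorability and `∩`-closedness. For unique factorisation
of values, each irreducible is the value of a generator, and the chosen generators commute. Two
products of them with equal value are then commuting, hence core-equivalent, hence have the same
letters outside the core. -/

theorem not_orthogonal_iff {s t : S} : ¬ Orthogonal s t ↔ ∃ x y : S, s * x = t * y := by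
  constructor
  · intro h
    obtain ⟨z, ⟨x, hx⟩, y, hy⟩ := Set.nonempty_iff_ne_empty.2 h
    exact ⟨x, y, hx.trans hy.symm⟩
  · rintro ⟨x, y, h⟩ ho
    have : s * x ∈ principal s ∩ principal t := ⟨⟨x, rfl⟩, y, h.symm⟩
    rw [show principal s ∩ principal t = ∅ from ho] at this
    exact this

theorem mem_core_iff {a : S} : a ∈ core S ↔ ∀ s : S, ∃ x y : S, a * x = s * y :=
  forall_congr' fun _ => not_orthogonal_iff

theorem one_mem_core : (1 : S) ∈ core S :=
  mem_core_iff.2 fun s => ⟨s, 1, by simp⟩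

theorem mul_mem_core {a b : S} (ha : a ∈ core S) (hb : b ∈ core S) : a * b ∈ core S := by
  rw [mem_core_iff] at *
  intro s
  obtain ⟨x, y, hxy⟩ := ha s
  obtain ⟨u, v, huv⟩ := hb x
  exact ⟨u, y * v, by rw [mul_assoc, huv, ← mul_assoc, hxy, mul_assoc]⟩

theorem mem_core_of_mul_mem_core {a b : S} (h : a * b ∈ core S) : a ∈ core S := by
  rw [mem_core_iff] at *
  intro s
  obtain ⟨x, y, hxy⟩ := h s
  exact ⟨b * x, y, by rw [← mul_assoc, hxy]⟩

/-- If core elements are central, then the core relation is an equivalence relation. -/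
theorem coreRel_equivalence_of_central (h : ∀ a ∈ core S, ∀ s : S, a * s = s * a) :
    Equivalence (CoreRel (S := S)) := by
  refine ⟨fun s => ⟨1, one_mem_core, 1, one_mem_core, rfl⟩, ?_, ?_⟩
  · rintro s t ⟨a, ha, b, hb, hab⟩
    exact ⟨b, hb, a, ha, hab.symm⟩
  · rintro s t u ⟨a, ha, b, hb, hab⟩ ⟨c, hc, d, hd, hcd⟩
    refine ⟨a * c, mul_mem_core ha hc, d * b, mul_mem_core hd hb, ?_⟩
    rw [← mul_assoc, hab, mul_assoc, h b hb, ← mul_assoc, hcd, mul_assoc]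

/-- Accuracy is only assumed for transversals. To use it on two given inequivalent elements, a
transversal through both is needed. -/
theorem exists_isTransversal (he : Equivalence (CoreRel (S := S))) {A : Set S} {s t : S}
    (hs : s ∈ A) (ht : t ∈ A) (hst : ¬ CoreRel s t) :
    ∃ T : Set S, IsTransversal A T ∧ s ∈ T ∧ t ∈ T := by
  classical
  let Q : Setoid A := ⟨fun x y => CoreRel x.1 y.1, fun x => he.refl _, fun h => he.symm h,
    fun h h' => he.trans h h'⟩
  let g : A → S := fun x => if CoreRel x.1 s then s else if CoreRel x.1 t then t else
    (Quotient.out (Quotient.mk Q x)).1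
  have hgA : ∀ x, g x ∈ A := fun x => by
    simp only [g]; split_ifs
    exacts [hs, ht, Subtype.property _]
  have hgr : ∀ x : A, CoreRel x.1 (g x) := fun x => by
    simp only [g]; split_ifs with h1 h2
    exacts [h1, h2, he.symm (Quotient.mk_out (s := Q) x)]
  have hgc : ∀ x y : A, CoreRel x.1 y.1 → g x = g y := fun x y h => by
    have e1 : ∀ z, CoreRel x.1 z ↔ CoreRel y.1 z := fun z =>
      ⟨he.trans (he.symm h), he.trans h⟩
    have e2 : Quotient.mk Q x = Quotient.mk Q y := Quotient.sound h
    simp only [g, e1, e2]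
  refine ⟨Set.range g, ⟨?_, ?_⟩, ⟨⟨s, hs⟩, ?_⟩, ⟨⟨t, ht⟩, ?_⟩⟩
  · rintro _ ⟨x, rfl⟩; exact hgA x
  · intro x hx
    refine ⟨g ⟨x, hx⟩, ⟨⟨_, rfl⟩, hgr ⟨x, hx⟩⟩, ?_⟩
    rintro _ ⟨⟨y, rfl⟩, hy⟩
    exact hgc _ _ (he.trans (hgr y) (he.symm hy))
  · simp [g, he.refl s]
  · have : ¬ CoreRel t s := fun h => hst (he.symm h)
    simp [g, he.refl t, this]

theorem IsGeneralisedScale.coreRel_or_orthogonal (he : Equivalence (CoreRel (S := S)))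
    {N : S →* ℕ+} (hN : IsGeneralisedScale N) {s t : S} (hst : N s = N t) :
    CoreRel s t ∨ Orthogonal s t := by
  by_cases h : CoreRel s t
  · exact Or.inl h
  · obtain ⟨T, hT, h1, h2⟩ := exists_isTransversal he (A := fibre N (N s)) rfl hst.symm h
    refine Or.inr (((hN.2 _ ⟨s, rfl⟩).2 T hT).2 s h1 t h2 ?_)
    rintro rfl
    exact h (he.refl s)

theorem coreClass_eq_iff (he : Equivalence (CoreRel (S := S))) {s t : S} :
    coreClass s = coreClass t ↔ CoreRel s t := by
  constructor
  · intro h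
    have : t ∈ coreClass t := he.refl t
    rwa [← h] at this
  · intro h
    ext x
    exact ⟨he.trans (he.symm h), he.trans h⟩

/-- The fibre over 1 is a single class, that of the identity. Conversely a core element is
orthogonal to nothing, so its fibre is a single class and its value is 1. -/
theorem IsGeneralisedScale.eq_one_iff (he : Equivalence (CoreRel (S := S)))
    {N : S →* ℕ+} (hN : IsGeneralisedScale N) {a : S} : N a = 1 ↔ a ∈ core S := by
  constructor
  · intro h
    have h1 := (hN.2 1 ⟨1, map_one N⟩).1
    rw [PNat.one_coe, Nat.cast_one, Set.encard_eq_one] at h1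
    obtain ⟨c, hc⟩ := h1
    have e1 : coreClass a ∈ coreClass '' fibre N 1 := ⟨a, h, rfl⟩
    have e2 : coreClass (1 : S) ∈ coreClass '' fibre N 1 := ⟨1, map_one N, rfl⟩
    rw [hc] at e1 e2
    obtain ⟨x, hx, y, hy, hxy⟩ := (coreClass_eq_iff he).1 (e1.trans e2.symm)
    rw [one_mul] at hxy
    exact mem_core_of_mul_mem_core (hxy ▸ hy : a * x ∈ core S)
  · intro h
    have h1 := (hN.2 (N a) ⟨a, rfl⟩).1
    have h2 : coreClass '' fibre N (N a) = {coreClass a} := by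
      refine Set.eq_singleton_iff_unique_mem.2 ⟨⟨a, rfl, rfl⟩, ?_⟩
      rintro _ ⟨s, hs, rfl⟩
      rw [coreClass_eq_iff he]
      refine (hN.coreRel_or_orthogonal he hs).resolve_right fun ho => h s ?_
      rwa [Orthogonal, Set.inter_comm]
    rw [h2, Set.encard_singleton] at h1
    exact PNat.eq (by exact_mod_cast h1.symm)

end General

/-! ### Letter counts, projections to free monoids and centrality of the core. -/

namespace RightAngledArtinMonoid

variable {V : Type*} {Γ : SimpleGraph V}

/-- The generator of the right-angled Artin monoid attached to a vertex. -/
def gen (Γ : SimpleGraph V) (v : V) : RightAngledArtinMonoid Γ := PresentedMonoid.of _ v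

theorem gen_mul_gen {v w : V} (h : Γ.Adj v w) : gen Γ v * gen Γ w = gen Γ w * gen Γ v :=
  PresentedMonoid.mk_eq_mk_of_rel (rels := artinRel Γ) ⟨v, w, h, rfl, rfl⟩

theorem exists_word (s : RightAngledArtinMonoid Γ) : ∃ l : List V, s = (l.map (gen Γ)).prod := by
  obtain ⟨l, rfl⟩ := PresentedMonoid.surjective_mk s
  refine ⟨l.toList, ?_⟩
  induction l using FreeMonoid.inductionOn' with
  | one => simp
  | of_mul v l ih => rw [map_mul, FreeMonoid.toList_of_mul, List.map_cons, List.prod_cons, ← ih]; rfl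

/-- The homomorphism determined by a map on vertices that respects commutation. -/
def lift {M : Type*} [Monoid M] (f : V → M) (hf : ∀ v w, Γ.Adj v w → f v * f w = f w * f v) :
    RightAngledArtinMonoid Γ →* M :=
  PresentedMonoid.lift f (by
    rintro _ _ ⟨v, w, h, rfl, rfl⟩
    simpa using hf v w h)

@[simp]
theorem lift_gen {M : Type*} [Monoid M] (f : V → M)
    (hf : ∀ v w, Γ.Adj v w → f v * f w = f w * f v) (v : V) : lift f hf (gen Γ v) = f v := rfl

open Classical in
/-- The number of occurrences of a vertex. -/
noncomputable def count (Γ : SimpleGraph V) (v : V) : RightAngledArtinMonoid Γ →* Multiplicative ℕ :=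
  lift (fun w => if w = v then Multiplicative.ofAdd 1 else 1) fun _ _ _ => mul_comm _ _

theorem count_gen_self (v : V) : count Γ v (gen Γ v) = Multiplicative.ofAdd 1 := by
  simp [count]

theorem count_gen_of_ne {v w : V} (h : w ≠ v) : count Γ v (gen Γ w) = 1 := by
  simp [count, h]

theorem count_word_eq_one {v : V} {l : List V} (h : v ∉ l) :
    count Γ v (l.map (gen Γ)).prod = 1 := by
  induction l with
  | nil => simp
  | cons w l ih =>
    simp only [List.mem_cons, not_or] at h
    rw [List.map_cons, List.prod_cons, map_mul, ih h.2, count_gen_of_ne (Ne.symm h.1), one_mul]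

open Classical in
/-- The endomorphism that keeps the generators in `P` and kills the others. -/
noncomputable def keep (Γ : SimpleGraph V) (P : V → Prop) :
    RightAngledArtinMonoid Γ →* RightAngledArtinMonoid Γ :=
  lift (fun v => if P v then gen Γ v else 1) fun v w h => by
    split_ifs <;> simp [gen_mul_gen h]

theorem keep_gen_of {P : V → Prop} {v : V} (h : P v) : keep Γ P (gen Γ v) = gen Γ v := by
  simp [keep, h]

theorem keep_gen_of_not {P : V → Prop} {v : V} (h : ¬ P v) : keep Γ P (gen Γ v) = 1 := by
  simp [keep, h]

open Classical in
/-- The homomorphism to the free monoid that keeps the generators in an independent set `P`. -/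
noncomputable def proj (P : V → Prop) (hP : ∀ v w, P v → P w → ¬ Γ.Adj v w) :
    RightAngledArtinMonoid Γ →* FreeMonoid V :=
  lift (fun v => if P v then FreeMonoid.of v else 1) fun v w h => by
    have := hP v w
    split_ifs <;> simp_all

section proj

variable {P : V → Prop} (hP : ∀ v w, P v → P w → ¬ Γ.Adj v w)

theorem proj_gen_of {v : V} (h : P v) : proj P hP (gen Γ v) = FreeMonoid.of v := by
  simp [proj, h]

theorem proj_gen_of_not {v : V} (h : ¬ P v) : proj P hP (gen Γ v) = 1 := by
  simp [proj, h]

end proj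

theorem of_mul_inj {v w : V} {x y : FreeMonoid V}
    (h : FreeMonoid.of v * x = FreeMonoid.of w * y) : v = w ∧ x = y := by
  have := congrArg FreeMonoid.toList h
  simpa using this

theorem pair_independent {v w : V} (h : ¬ Γ.Adj v w) :
    ∀ a b, (a = v ∨ a = w) → (b = v ∨ b = w) → ¬ Γ.Adj a b := by
  rintro a b (rfl | rfl) (rfl | rfl) h'
  exacts [h'.ne rfl, h h', h h'.symm, h'.ne rfl]

theorem eq_or_adj_of_gen_mul_eq {v w : V} {x y : RightAngledArtinMonoid Γ}
    (h : gen Γ v * x = gen Γ w * y) : v = w ∨ Γ.Adj v w := by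
  by_contra hc
  rw [not_or] at hc
  have := congrArg (proj _ (pair_independent hc.2)) h
  rw [map_mul, map_mul, proj_gen_of (pair_independent hc.2) (v := v) (Or.inl rfl),
    proj_gen_of (pair_independent hc.2) (v := w) (Or.inr rfl)] at this
  exact hc.1 (of_mul_inj this).1

theorem exists_proj_word {P : V → Prop} (hP : ∀ v w, P v → P w → ¬ Γ.Adj v w) {l : List V}
    (h : ∃ v ∈ l, P v) : ∃ v, P v ∧ ∃ m, proj P hP (l.map (gen Γ)).prod = FreeMonoid.of v * m := by
  induction l with
  | nil => simp at h
  | cons u l ih =>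
    rw [List.map_cons, List.prod_cons, map_mul]
    by_cases hu : P u
    · exact ⟨u, hu, _, by rw [proj_gen_of hP hu]⟩
    · rw [proj_gen_of_not hP hu, one_mul]
      refine ih ?_
      obtain ⟨v, hv, hPv⟩ := h
      rcases List.mem_cons.1 hv with rfl | hv
      · exact absurd hPv hu
      · exact ⟨v, hv, hPv⟩

/-- If `v` and `w` were not adjacent, the word would project to a nonempty element of the free
monoid on them. A generator different from its first letter would be orthogonal to the word. -/
theorem adj_of_word_mem_core {l : List V}
    (h : (l.map (gen Γ)).prod ∈ core (RightAngledArtinMonoid Γ)) {v w : V} (hv : v ∈ l)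
    (hw : w ≠ v) : Γ.Adj v w := by
  by_contra hc
  obtain ⟨u, hu, m, hm⟩ := exists_proj_word (pair_independent hc) ⟨v, hv, Or.inl rfl⟩
  obtain ⟨u', hu', hne⟩ : ∃ u', (u' = v ∨ u' = w) ∧ u ≠ u' := by
    rcases hu with rfl | rfl
    exacts [⟨w, Or.inr rfl, hw.symm⟩, ⟨v, Or.inl rfl, hw⟩]
  obtain ⟨x, y, hxy⟩ := mem_core_iff.1 h (gen Γ u')
  have := congrArg (proj _ (pair_independent hc)) hxy
  rw [map_mul, map_mul, hm, proj_gen_of (pair_independent hc) (v := u') hu', mul_assoc] at this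
  exact hne (of_mul_inj this).1

theorem commute_word {l : List V} {s : RightAngledArtinMonoid Γ}
    (h : ∀ v ∈ l, Commute (gen Γ v) s) : Commute (l.map (gen Γ)).prod s := by
  refine Commute.list_prod_left _ _ fun x hx => ?_
  obtain ⟨v, hv, rfl⟩ := List.mem_map.1 hx
  exact h v hv

theorem commute_gen {v w : V} (h : v ≠ w → Γ.Adj v w) : Commute (gen Γ v) (gen Γ w) := by
  by_cases e : v = w
  · rw [e]
  · exact gen_mul_gen (h e)

theorem central_of_mem_core {a : RightAngledArtinMonoid Γ}
    (ha : a ∈ core (RightAngledArtinMonoid Γ)) (s : RightAngledArtinMonoid Γ) :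
    a * s = s * a := by
  obtain ⟨l, rfl⟩ := exists_word a
  obtain ⟨k, rfl⟩ := exists_word s
  refine commute_word fun v hv => (commute_word fun w _ => commute_gen fun hne => ?_).symm
  exact (adj_of_word_mem_core ha hv hne).symm

/-- Centrality of the core replaces the right LCM property, which is not yet known for this monoid.
-/
theorem coreRel_equivalence : Equivalence (CoreRel (S := RightAngledArtinMonoid Γ)) :=
  coreRel_equivalence_of_central fun _ ha s => central_of_mem_core ha s

/-! ### Adjacency is determined by the scale. -/

section Scale

variable {N : RightAngledArtinMonoid Γ →* ℕ+}

theorem eq_one_of_mul_eq_one {a b : ℕ+} (h : a * b = 1) : a = 1 ∧ b = 1 :=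
  ⟨PNat.dvd_one_iff _ |>.1 ⟨b, h.symm⟩, PNat.dvd_one_iff _ |>.1 ⟨a, by rw [mul_comm, h]⟩⟩

theorem apply_gen_dvd_apply_word {v : V} {l : List V} (h : v ∈ l) :
    N (gen Γ v) ∣ N (l.map (gen Γ)).prod := by
  rw [map_list_prod, List.map_map]
  exact List.dvd_prod (List.mem_map.2 ⟨v, h, rfl⟩)

theorem count_eq_one_of_apply_eq_one {v : V} (hv : N (gen Γ v) ≠ 1)
    {a : RightAngledArtinMonoid Γ} (ha : N a = 1) : count Γ v a = 1 := by
  obtain ⟨l, rfl⟩ := exists_word a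
  refine count_word_eq_one fun h => hv ?_
  have := apply_gen_dvd_apply_word (N := N) h
  rw [ha] at this
  exact PNat.dvd_one_iff _ |>.1 this

variable (hN : IsGeneralisedScale N)
include hN

theorem apply_eq_one_iff_mem_core {a : RightAngledArtinMonoid Γ} :
    N a = 1 ↔ a ∈ core (RightAngledArtinMonoid Γ) :=
  hN.eq_one_iff coreRel_equivalence

theorem adj_of_apply_gen_eq_one {v w : V} (hv : N (gen Γ v) = 1) (h : w ≠ v) : Γ.Adj v w := by
  refine adj_of_word_mem_core (l := [v]) ?_ (List.mem_singleton_self v) h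
  simpa using (apply_eq_one_iff_mem_core hN).1 hv

theorem count_eq_of_coreRel {v : V} (hv : N (gen Γ v) ≠ 1) {s t : RightAngledArtinMonoid Γ}
    (h : CoreRel s t) : count Γ v s = count Γ v t := by
  obtain ⟨a, ha, b, hb, hab⟩ := h
  have := congrArg (count Γ v) hab
  rwa [map_mul, map_mul,
    count_eq_one_of_apply_eq_one hv ((apply_eq_one_iff_mem_core hN).2 ha),
    count_eq_one_of_apply_eq_one hv ((apply_eq_one_iff_mem_core hN).2 hb),
    mul_one, mul_one] at this

/-- Commuting elements with the same value contain each vertex outside the core equally often. -/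
theorem count_eq_of_commute {v : V} (hv : N (gen Γ v) ≠ 1) {s t : RightAngledArtinMonoid Γ}
    (hst : N s = N t) (h : Commute s t) : count Γ v s = count Γ v t := by
  refine count_eq_of_coreRel hN hv
    ((hN.coreRel_or_orthogonal coreRel_equivalence hst).resolve_right ?_)
  exact not_orthogonal_iff.2 ⟨t, s, h⟩

theorem isTransversal_gen {n : ℕ+} (hn : n ≠ 1)
    (h : ∀ s : RightAngledArtinMonoid Γ, N s = n → ∃ w, N (gen Γ w) = n ∧ CoreRel s (gen Γ w)) :
    IsTransversal (fibre N n) (gen Γ '' {w | N (gen Γ w) = n}) := by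
  refine ⟨?_, fun s hs => ?_⟩
  · rintro _ ⟨w, hw, rfl⟩
    exact hw
  · obtain ⟨w, hw, hsw⟩ := h s hs
    refine ⟨gen Γ w, ⟨⟨w, hw, rfl⟩, hsw⟩, ?_⟩
    rintro _ ⟨⟨u, hu, rfl⟩, hsu⟩
    by_contra hne
    have h1 := count_eq_of_coreRel hN (v := w) (hw.trans_ne hn)
      (coreRel_equivalence.trans (coreRel_equivalence.symm hsu) hsw)
    rw [count_gen_self, count_gen_of_ne (by rintro rfl; exact hne rfl)] at h1
    exact absurd h1 (by decide)

/-- If a fibre is represented by its generators, then these generators form a join factor. -/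
theorem adj_iff_of_represented {n : ℕ+} (hn : n ≠ 1)
    (h : ∀ s : RightAngledArtinMonoid Γ, N s = n → ∃ w, N (gen Γ w) = n ∧ CoreRel s (gen Γ w))
    {v w : V} (hv : N (gen Γ v) = n) : Γ.Adj v w ↔ N (gen Γ w) ≠ n := by
  have hT := (hN.2 n ⟨_, hv⟩).2 _ (isTransversal_gen hN hn h)
  have key : ∀ u u' : V, N (gen Γ u) = n → N (gen Γ u') = n → ¬ Γ.Adj u u' := by
    intro u u' hu hu' hadj
    have hne : gen Γ u ≠ gen Γ u' := by
      intro e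
      have := congrArg (count Γ u) e
      rw [count_gen_self, count_gen_of_ne hadj.ne'] at this
      exact absurd this (by decide)
    exact not_orthogonal_iff.2 ⟨_, _, gen_mul_gen hadj⟩ (hT.2 _ ⟨u, hu, rfl⟩ _ ⟨u', hu', rfl⟩ hne)
  refine ⟨fun hadj hw => key v w hv hw hadj, fun hw => ?_⟩
  by_contra hadj
  -- Some `u` of value `n` has a common multiple with `wv`. Then `u` is adjacent to `w`, so `u ≠ v`,
  -- but projecting to the letters `u`, `v` erases `w` and equates words starting with `u` and `v`.
  obtain ⟨_, ⟨u, hu, rfl⟩, ho⟩ := hT.1.2 (gen Γ w * gen Γ v)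
  obtain ⟨x, y, hxy⟩ := not_orthogonal_iff.1 ho
  rw [mul_assoc] at hxy
  rcases eq_or_adj_of_gen_mul_eq hxy with rfl | hwu
  · exact hw hu
  have huv : u ≠ v := by
    rintro rfl
    exact hadj hwu
  have h1 := congrArg (proj _ (pair_independent (key u v hu hv))) hxy
  rw [map_mul, map_mul, map_mul, proj_gen_of (pair_independent (key u v hu hv)) (v := u) (Or.inl rfl),
    proj_gen_of (pair_independent (key u v hu hv)) (v := v) (Or.inr rfl),
    proj_gen_of_not, one_mul] at h1
  · exact huv (of_mul_inj h1).1
  · rintro (rfl | rfl)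
    exacts [hw hu, hw hv]

/-- By induction on the value `n`, each element of value `n` is core-equivalent to a generator, so
`adj_iff_of_represented` applies. -/
theorem adj_iff_apply_gen_ne {v w : V} (hv : N (gen Γ v) ≠ 1) :
    Γ.Adj v w ↔ N (gen Γ w) ≠ N (gen Γ v) := by
  suffices H : ∀ n : ℕ+, ∀ v w : V, N (gen Γ v) = n → n ≠ 1 → (Γ.Adj v w ↔ N (gen Γ w) ≠ n) from
    H _ v w rfl hv
  clear hv v w
  intro n
  induction n using PNat.strongInductionOn with
  | _ n ih =>
  intro v w hv hn
  refine adj_iff_of_represented hN hn (fun s hs => ?_) hv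
  obtain ⟨l, rfl⟩ := exists_word s
  by_cases hl : ∃ u ∈ l, N (gen Γ u) = n
  · obtain ⟨u, hul, hu⟩ := hl
    refine ⟨u, hu, ?_⟩
    obtain ⟨l₁, l₂, rfl⟩ := List.append_of_mem hul
    rw [List.map_append, List.map_cons, List.prod_append, List.prod_cons] at hs ⊢
    rw [map_mul, map_mul, hu, mul_left_comm, mul_eq_left] at hs
    -- The letter `u` already accounts for the whole value, so the rest of the word is core.
    replace hs := eq_one_of_mul_eq_one hs
    have h1 := (apply_eq_one_iff_mem_core hN).1 hs.1
    have h2 := (apply_eq_one_iff_mem_core hN).1 hs.2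
    refine ⟨1, one_mem_core, _, mul_mem_core h1 h2, ?_⟩
    rw [mul_one, ← mul_assoc, ← mul_assoc, central_of_mem_core h1]
  · push Not at hl
    have hvl : v ∉ l := fun h => hl v h hv
    -- Without a letter of value `n`, every letter has value 1 or a smaller value covered by
    -- induction, hence is adjacent to `v`. The word then commutes with `v` without containing it,
    -- contradicting `count_eq_of_commute`.
    have hc : Commute (l.map (gen Γ)).prod (gen Γ v) := by
      refine commute_word fun u hu => commute_gen fun huv => ?_
      by_cases hu1 : N (gen Γ u) = 1
      · exact adj_of_apply_gen_eq_one hN hu1 huv.symm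
      · have hle : N (gen Γ u) ≤ n := hs ▸ PNat.le_of_dvd (apply_gen_dvd_apply_word hu)
        have hlt := lt_of_le_of_ne hle (hl u hu)
        exact (ih _ hlt u v rfl hu1).2 (hv.trans_ne hlt.ne')
    have := count_eq_of_commute hN (hv.trans_ne hn) (hs.trans hv.symm) hc
    rw [count_gen_self, count_word_eq_one hvl] at this
    exact absurd this (by decide)

theorem not_adj_trans {u v w : V} (h1 : ¬ Γ.Adj u v) (h2 : ¬ Γ.Adj v w) : ¬ Γ.Adj u w := by
  by_cases hv : N (gen Γ v) = 1
  · have : u = v := by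
      by_contra h
      exact h1 (adj_of_apply_gen_eq_one hN hv h).symm
    rwa [this]
  · rw [SimpleGraph.adj_comm, adj_iff_apply_gen_ne hN hv, not_not] at h1
    rw [adj_iff_apply_gen_ne hN hv, not_not] at h2
    rw [adj_iff_apply_gen_ne hN (h1.trans_ne hv), not_not, h1, h2]

end Scale

/-! ### Cancellation and LCMs over a complete multipartite graph. -/

section Multipartite

variable (htr : ∀ u v w : V, ¬ Γ.Adj u v → ¬ Γ.Adj v w → ¬ Γ.Adj u w)
include htr

theorem class_independent (v a b : V) (ha : ¬ Γ.Adj v a) (hb : ¬ Γ.Adj v b) : ¬ Γ.Adj a b :=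
  htr a v b (fun h => ha h.symm) hb

/-- Letters outside the class of `v` commute with `v`, so the first letter from the class can be
moved to the front. -/
theorem exists_eq_gen_mul {v : V} {y : RightAngledArtinMonoid Γ} {m : FreeMonoid V}
    (h : proj _ (class_independent htr v) y = FreeMonoid.of v * m) : ∃ z, y = gen Γ v * z := by
  obtain ⟨l, rfl⟩ := exists_word y
  induction l with
  | nil =>
    have := congrArg FreeMonoid.length h
    simp [FreeMonoid.length_mul] at this
    omega
  | cons w l ih =>
    rw [List.map_cons, List.prod_cons] at h ⊢
    by_cases hw : Γ.Adj v w
    · rw [map_mul, proj_gen_of_not (class_independent htr v) (v := w) (not_not.2 hw), one_mul] at h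
      obtain ⟨z, hz⟩ := ih h
      exact ⟨gen Γ w * z, by rw [hz, ← mul_assoc, ← gen_mul_gen hw, mul_assoc]⟩
    · rw [map_mul, proj_gen_of (class_independent htr v) (v := w) hw] at h
      rw [(of_mul_inj h).1]
      exact ⟨_, rfl⟩

/-- The first letter of `x` starts the projection of `y` to its class, so it also divides `y` and
can be cancelled in each free monoid. -/
theorem eq_of_proj_eq {x y : RightAngledArtinMonoid Γ}
    (h : ∀ v, proj _ (class_independent htr v) x = proj _ (class_independent htr v) y) :
    x = y := by
  obtain ⟨l, rfl⟩ := exists_word x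
  induction l generalizing y with
  | nil =>
    obtain ⟨k, rfl⟩ := exists_word y
    cases k with
    | nil => rfl
    | cons w k =>
      have := congrArg FreeMonoid.length (h w)
      rw [List.map_cons, List.prod_cons, map_mul,
        proj_gen_of (class_independent htr w) (v := w) Γ.irrefl] at this
      simp [FreeMonoid.length_mul] at this
      omega
  | cons v l ih =>
    rw [List.map_cons, List.prod_cons] at h ⊢
    have hv := h v
    rw [map_mul, proj_gen_of (class_independent htr v) (v := v) Γ.irrefl] at hv
    obtain ⟨z, rfl⟩ := exists_eq_gen_mul htr hv.symm
    rw [ih fun u => mul_left_cancel (a := proj _ (class_independent htr u) (gen Γ v)) ?_]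
    rw [← map_mul, ← map_mul, h u]

theorem isLeftCancelMul : IsLeftCancelMul (RightAngledArtinMonoid Γ) :=
  ⟨fun a x y h => eq_of_proj_eq htr fun v =>
    mul_left_cancel (a := proj _ (class_independent htr v) a) <| by
      rw [← map_mul, ← map_mul]; exact congrArg _ h⟩

/-- A generator either divides `t` or commutes with `t` as soon as the two are not orthogonal. -/
theorem exists_eq_gen_mul_or_commute {v : V} {x y t : RightAngledArtinMonoid Γ}
    (h : gen Γ v * x = t * y) :
    (∃ z, t = gen Γ v * z) ∨ Commute (gen Γ v) t ∧ ∃ z, y = gen Γ v * z := by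
  obtain ⟨l, rfl⟩ := exists_word t
  have hp := congrArg (proj _ (class_independent htr v)) h
  rw [map_mul, map_mul, proj_gen_of (class_independent htr v) (v := v) Γ.irrefl] at hp
  by_cases hl : ∃ w ∈ l, ¬ Γ.Adj v w
  · obtain ⟨u, hu, m, hm⟩ := exists_proj_word (class_independent htr v) hl
    rw [hm, mul_assoc] at hp
    rw [← (of_mul_inj hp).1] at hm
    exact Or.inl (exists_eq_gen_mul htr hm)
  · push Not at hl
    have h1 : proj _ (class_independent htr v) (l.map (gen Γ)).prod = 1 := by
      rw [map_list_prod]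
      refine List.prod_eq_one fun x hx => ?_
      simp only [List.mem_map] at hx
      obtain ⟨_, ⟨w, hw, rfl⟩, rfl⟩ := hx
      exact proj_gen_of_not _ (not_not.2 (hl w hw))
    rw [h1, one_mul] at hp
    exact Or.inr ⟨(commute_word fun w hw => (gen_mul_gen (hl w hw)).symm).symm,
      exists_eq_gen_mul htr hp.symm⟩

/-- Induction on a word for `s` with first letter `v`. If `v` divides `t`, it is cancelled from
both. Otherwise `v` commutes with `t`, and an LCM of the remainder of `s` with `t` is multiplied by
`v`. -/
theorem exists_lcm (s t : RightAngledArtinMonoid Γ) (h : ∃ x y, s * x = t * y) :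
    ∃ r, principal s ∩ principal t = principal r := by
  have hcanc := isLeftCancelMul htr
  obtain ⟨l, rfl⟩ := exists_word s
  induction l generalizing t with
  | nil =>
    refine ⟨t, Set.inter_eq_right.2 fun z _ => ⟨z, by simp⟩⟩
  | cons v l ih =>
    rw [List.map_cons, List.prod_cons] at h ⊢
    generalize (l.map (gen Γ)).prod = s at *
    obtain ⟨x, y, hxy⟩ := h
    have hxy' := hxy
    rw [mul_assoc] at hxy'
    by_cases ht : ∃ z, t = gen Γ v * z
    · obtain ⟨t, rfl⟩ := ht
      rw [mul_assoc] at hxy'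
      obtain ⟨r, hr⟩ := ih t ⟨x, y, mul_left_cancel hxy'⟩
      refine ⟨gen Γ v * r, ?_⟩
      have e : ∀ a : RightAngledArtinMonoid Γ,
          principal (gen Γ v * a) = (gen Γ v * ·) '' principal a := fun a => by
        simp only [principal, ← Set.range_comp]
        exact congrArg Set.range (funext fun b => mul_assoc _ _ _)
      rw [e, e, e, ← hr, Set.image_inter (mul_right_injective _)]
    · obtain ⟨hc, y, rfl⟩ := (exists_eq_gen_mul_or_commute htr hxy').resolve_left ht
      rw [← mul_assoc t, ← hc.eq, mul_assoc] at hxy'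
      obtain ⟨r, hr⟩ := ih t ⟨x, y, mul_left_cancel hxy'⟩
      refine ⟨gen Γ v * r, Set.Subset.antisymm ?_ ?_⟩
      · rintro _ ⟨⟨p, rfl⟩, q, hq⟩
        simp only at hq
        rw [mul_assoc] at hq
        -- Since `v` does not divide `t`, it must divide the cofactor `q` of any common multiple.
        obtain ⟨-, q, rfl⟩ := (exists_eq_gen_mul_or_commute htr hq.symm).resolve_left ht
        rw [← mul_assoc t, ← hc.eq, mul_assoc] at hq
        have hm : s * p ∈ principal s ∩ principal t := ⟨⟨p, rfl⟩, q, mul_left_cancel hq⟩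
        rw [hr] at hm
        obtain ⟨c, hc'⟩ := hm
        exact ⟨c, by simp only at hc' ⊢; rw [mul_assoc, hc', mul_assoc]⟩
      · rintro _ ⟨c, rfl⟩
        have hm : r * c ∈ principal s ∩ principal t := by rw [hr]; exact ⟨c, rfl⟩
        obtain ⟨⟨p, hp⟩, q, hq⟩ := hm
        simp only at hp hq
        refine ⟨⟨p, ?_⟩, gen Γ v * q, ?_⟩
        · simp only [mul_assoc, hp]
        · simp only
          rw [← mul_assoc, ← hc.eq, mul_assoc, hq, mul_assoc]

theorem isRightLCM : IsRightLCM (RightAngledArtinMonoid Γ) :=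
  ⟨isLeftCancelMul htr, fun s t => or_iff_not_imp_left.2 fun h =>
    exists_lcm htr s t (not_orthogonal_iff.1 h)⟩

end Multipartite

/-- The total number of letters. -/
def length (Γ : SimpleGraph V) : RightAngledArtinMonoid Γ →* Multiplicative ℕ :=
  lift (fun _ => Multiplicative.ofAdd 1) fun _ _ _ => rfl

theorem eq_one_of_length_eq_one {a : RightAngledArtinMonoid Γ} (h : length Γ a = 1) : a = 1 := by
  obtain ⟨l, rfl⟩ := exists_word a
  cases l with
  | nil => rfl
  | cons v l =>
    rw [List.map_cons, List.prod_cons, map_mul] at h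
    have := congrArg Multiplicative.toAdd h
    simp [length] at this

theorem eq_one_of_mul_eq_one_right {a b : RightAngledArtinMonoid Γ} (h : a * b = 1) : b = 1 := by
  refine eq_one_of_length_eq_one ?_
  have := congrArg (fun x => Multiplicative.toAdd (length Γ x)) h
  simp only [map_mul, map_one, toAdd_mul, toAdd_one] at this
  exact Multiplicative.toAdd.injective (by rw [toAdd_one]; omega)

/-! ### Core factorisation and closure under intersections. -/

section Scale

variable {N : RightAngledArtinMonoid Γ →* ℕ+}

/-- The part of an element written in the generators of value one. -/
noncomputable def corePart (N : RightAngledArtinMonoid Γ →* ℕ+) :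
    RightAngledArtinMonoid Γ →* RightAngledArtinMonoid Γ :=
  keep Γ fun v => N (gen Γ v) = 1

/-- The part of an element written in the generators of value different from one. -/
noncomputable def idealPart (N : RightAngledArtinMonoid Γ →* ℕ+) :
    RightAngledArtinMonoid Γ →* RightAngledArtinMonoid Γ :=
  keep Γ fun v => N (gen Γ v) ≠ 1

theorem corePart_gen_of {v : V} (h : N (gen Γ v) = 1) : corePart N (gen Γ v) = gen Γ v :=
  keep_gen_of (P := fun v => N (gen Γ v) = 1) h

theorem corePart_gen_of_not {v : V} (h : N (gen Γ v) ≠ 1) : corePart N (gen Γ v) = 1 :=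
  keep_gen_of_not (P := fun v => N (gen Γ v) = 1) h

theorem idealPart_gen_of {v : V} (h : N (gen Γ v) ≠ 1) : idealPart N (gen Γ v) = gen Γ v :=
  keep_gen_of (P := fun v => N (gen Γ v) ≠ 1) h

theorem idealPart_gen_of_not {v : V} (h : N (gen Γ v) = 1) : idealPart N (gen Γ v) = 1 :=
  keep_gen_of_not (P := fun v => N (gen Γ v) ≠ 1) (not_not.2 h)

theorem corePart_idealPart (s : RightAngledArtinMonoid Γ) : corePart N (idealPart N s) = 1 := by
  obtain ⟨l, rfl⟩ := exists_word s
  rw [map_list_prod, map_list_prod]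
  refine List.prod_eq_one fun x hx => ?_
  simp only [List.mem_map] at hx
  obtain ⟨_, ⟨_, ⟨v, -, rfl⟩, rfl⟩, rfl⟩ := hx
  by_cases h : N (gen Γ v) = 1
  · rw [idealPart_gen_of_not h, map_one]
  · rw [idealPart_gen_of h, corePart_gen_of_not h]

theorem apply_corePart (s : RightAngledArtinMonoid Γ) : N (corePart N s) = 1 := by
  obtain ⟨l, rfl⟩ := exists_word s
  rw [map_list_prod, map_list_prod]
  refine List.prod_eq_one fun x hx => ?_
  simp only [List.mem_map] at hx
  obtain ⟨_, ⟨_, ⟨v, -, rfl⟩, rfl⟩, rfl⟩ := hx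
  by_cases h : N (gen Γ v) = 1
  · rw [corePart_gen_of h, h]
  · rw [corePart_gen_of_not h, map_one]

theorem corePart_eq_self {s : RightAngledArtinMonoid Γ} (hs : N s = 1) : corePart N s = s := by
  obtain ⟨l, rfl⟩ := exists_word s
  rw [map_list_prod, List.map_map]
  congr 1
  refine List.map_congr_left fun v hv => corePart_gen_of ?_
  have := apply_gen_dvd_apply_word (N := N) hv
  rw [hs] at this
  exact PNat.dvd_one_iff _ |>.1 this

variable (hN : IsGeneralisedScale N)
include hN

theorem idealPart_mul_corePart (s : RightAngledArtinMonoid Γ) :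
    idealPart N s * corePart N s = s := by
  obtain ⟨l, rfl⟩ := exists_word s
  induction l with
  | nil => simp
  | cons v l ih =>
    rw [List.map_cons, List.prod_cons, map_mul, map_mul]
    generalize (l.map (gen Γ)).prod = s at *
    have hv : idealPart N (gen Γ v) * corePart N (gen Γ v) = gen Γ v := by
      by_cases h : N (gen Γ v) = 1
      · rw [idealPart_gen_of_not h, corePart_gen_of h, one_mul]
      · rw [idealPart_gen_of h, corePart_gen_of_not h, mul_one]
    have hc := central_of_mem_core ((apply_eq_one_iff_mem_core hN).1 (apply_corePart (gen Γ v)))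
      (idealPart N s)
    rw [mul_assoc, ← mul_assoc (idealPart N s), ← hc, mul_assoc, ih, ← mul_assoc, hv]

/-- The core part of `s` is a core right factor, and only the identity is invertible. Conversely
`corePart` fixes every core right factor, which then divides `corePart N s`. -/
theorem mem_coreIrreducible_iff {s : RightAngledArtinMonoid Γ} :
    s ∈ coreIrreducible (RightAngledArtinMonoid Γ) ↔ N s ≠ 1 ∧ corePart N s = 1 := by
  have hcore : ∀ a, N a = 1 ↔ a ∈ core (RightAngledArtinMonoid Γ) := fun _ =>
    apply_eq_one_iff_mem_core hN
  rw [coreIrreducible, Set.mem_ofPred_eq, ← hcore, ← ne_eq]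
  refine and_congr_right fun _ => ⟨fun h => ?_, fun h t a ha e => ?_⟩
  · obtain ⟨u, hu⟩ := h _ _ ((hcore _).1 (apply_corePart s)) (idealPart_mul_corePart hN s).symm
    rw [← hu]
    exact eq_one_of_mul_eq_one_right u.inv_mul
  · rw [e, map_mul, corePart_eq_self ((hcore a).2 ha)] at h
    rw [eq_one_of_mul_eq_one_right h]
    exact isUnit_one

theorem isCoreFactorable : IsCoreFactorable (RightAngledArtinMonoid Γ) := by
  intro s
  refine ⟨idealPart N s, ?_, corePart N s, (apply_eq_one_iff_mem_core hN).1 (apply_corePart s),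
    (idealPart_mul_corePart hN s).symm⟩
  by_cases h : N (idealPart N s) = 1
  · right
    rw [Set.mem_singleton_iff, ← corePart_eq_self h, corePart_idealPart]
  · exact Or.inl ((mem_coreIrreducible_iff hN).2 ⟨h, corePart_idealPart s⟩)

theorem isCapClosed : IsCapClosed (RightAngledArtinMonoid Γ) := by
  intro s hs t ht r hr
  rw [mem_coreIrreducible_iff hN] at *
  have hm : r ∈ principal s ∩ principal t := by rw [hr]; exact ⟨1, mul_one r⟩
  have fix : ∀ {u : RightAngledArtinMonoid Γ}, corePart N u = 1 → idealPart N u = u := by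
    intro u hu
    have := idealPart_mul_corePart hN u
    rwa [hu, mul_one] at this
  obtain ⟨⟨x, hx⟩, y, hy⟩ := hm
  simp only at hx hy
  constructor
  · intro h
    rw [← hx, map_mul] at h
    exact hs.1 (eq_one_of_mul_eq_one h).1
  -- As `idealPart` fixes `s` and `t`, it sends their LCM `r` to a common multiple `rz`. Its core
  -- part is trivial, hence so is that of `r`.
  · have hm : idealPart N r ∈ principal s ∩ principal t :=
      ⟨⟨idealPart N x, by simp only; rw [← hx, map_mul, fix hs.2]⟩,
        ⟨idealPart N y, by simp only; rw [← hy, map_mul, fix ht.2]⟩⟩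
    rw [hr] at hm
    obtain ⟨z, hz⟩ := hm
    have := congrArg (corePart N) hz
    simp only [map_mul, corePart_idealPart] at this
    have hc := central_of_mem_core ((apply_eq_one_iff_mem_core hN).1 (apply_corePart r))
      (corePart N z)
    rw [hc] at this
    exact eq_one_of_mul_eq_one_right this

/-! ### Unique factorisation in the monoid of values. -/

omit hN in
theorem mrange_isUnit_iff {x : MonoidHom.mrange N} : IsUnit x ↔ x = 1 := by
  refine ⟨?_, fun h => h ▸ isUnit_one⟩
  rintro ⟨u, rfl⟩
  have := congrArg Subtype.val u.mul_inv
  exact Subtype.ext (eq_one_of_mul_eq_one this).1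

omit hN in
theorem exists_multiset_irreducible (x : MonoidHom.mrange N) :
    ∃ F : Multiset {x : MonoidHom.mrange N // Irreducible x}, (F.map Subtype.val).prod = x := by
  obtain ⟨n, hn⟩ : ∃ n, x.1 = n := ⟨_, rfl⟩
  induction n using PNat.strongInductionOn generalizing x with
  | _ n ih =>
  by_cases h1 : x = 1
  · exact ⟨0, by simp [h1]⟩
  by_cases hx : Irreducible x
  · exact ⟨{⟨x, hx⟩}, by simp⟩
  obtain ⟨a, b, hab, ha, hb⟩ : ∃ a b, x = a * b ∧ ¬ IsUnit a ∧ ¬ IsUnit b := by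
    rw [irreducible_iff] at hx
    push Not at hx
    exact hx (mt mrange_isUnit_iff.1 h1)
  rw [mrange_isUnit_iff] at ha hb
  have hv : a.1 * b.1 = n := by rw [← hn, hab]; rfl
  have ha' : 1 < a.1 := lt_of_le_of_ne one_le fun h => ha (Subtype.ext h.symm)
  have hb' : 1 < b.1 := lt_of_le_of_ne one_le fun h => hb (Subtype.ext h.symm)
  obtain ⟨F, hF⟩ := ih a.1 (hv ▸ lt_mul_of_one_lt_right' _ hb') a rfl
  obtain ⟨G, hG⟩ := ih b.1 (hv ▸ lt_mul_of_one_lt_left' _ ha') b rfl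
  exact ⟨F + G, by rw [Multiset.map_add, Multiset.prod_add, hF, hG, hab]⟩

omit hN in
theorem exists_gen_of_irreducible (x : MonoidHom.mrange N) (hx : Irreducible x) :
    ∃ v, N (gen Γ v) = x.1 := by
  obtain ⟨s, hs⟩ := x.2
  obtain ⟨l, rfl⟩ := exists_word s
  induction l with
  | nil =>
    refine absurd ?_ hx.1
    rw [mrange_isUnit_iff]
    exact Subtype.ext (by rw [← hs]; simp)
  | cons v l ih =>
    rw [List.map_cons, List.prod_cons, map_mul] at hs
    rcases hx.2 (a := ⟨_, gen Γ v, rfl⟩) (b := ⟨_, (l.map (gen Γ)).prod, rfl⟩)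
      (Subtype.ext hs.symm) with h | h
    · have := congrArg Subtype.val (mrange_isUnit_iff.1 h)
      simp only [OneMemClass.coe_one] at this
      exact ih (by rw [← hs, this, one_mul])
    · have := congrArg Subtype.val (mrange_isUnit_iff.1 h)
      simp only [OneMemClass.coe_one] at this
      exact ⟨v, by rw [← hs, this, mul_one]⟩

theorem isFreelyGeneratedByIrreducibles :
    IsFreelyGeneratedByIrreducibles (MonoidHom.mrange N) := by
  classical
  refine ⟨fun F G hFG => ?_, exists_multiset_irreducible⟩
  choose g hg using fun x : {x : MonoidHom.mrange N // Irreducible x} =>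
    exists_gen_of_irreducible x.1 x.2
  have hinj : Function.Injective g := fun x y h => by
    refine Subtype.ext (Subtype.ext ?_)
    rw [← hg, ← hg, h]
  have hne : ∀ x, N (gen Γ (g x)) ≠ 1 := fun x h => x.2.1 <| mrange_isUnit_iff.2 <|
    Subtype.ext ((hg x).symm.trans h)
  -- A multiset of irreducibles is lifted to a product of chosen generators with the same total
  -- value.
  let σ : Multiset {x : MonoidHom.mrange N // Irreducible x} → RightAngledArtinMonoid Γ :=
    fun F => ((F.toList.map g).map (gen Γ)).prod
  have hσN : ∀ F, N (σ F) = ((F.map Subtype.val).prod : MonoidHom.mrange N).1 := fun F => by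
    have hl : ∀ l : List {x : MonoidHom.mrange N // Irreducible x},
        N ((l.map g).map (gen Γ)).prod = ((l.map Subtype.val).prod : MonoidHom.mrange N).1 := by
      intro l
      induction l with
      | nil => simp
      | cons x l ih =>
        rw [List.map_cons, List.map_cons, List.prod_cons, map_mul, ih, hg, List.map_cons,
          List.prod_cons]
        rfl
    rw [hl, Multiset.prod_map_toList]
  -- Distinct chosen generators have distinct values, none equal to 1, so they are adjacent.
  have hcomm : Commute (σ F) (σ G) := by
    refine commute_word fun u hu => (commute_word fun w hw => commute_gen fun h => ?_).symm
    obtain ⟨x, -, rfl⟩ := List.mem_map.1 hu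
    obtain ⟨y, -, rfl⟩ := List.mem_map.1 hw
    rw [adj_iff_apply_gen_ne hN (hne y), hg, hg]
    exact fun e => h (congrArg g (Subtype.ext (Subtype.ext e))).symm
  have hcount : ∀ (l : List {x : MonoidHom.mrange N // Irreducible x}) x,
      count Γ (g x) ((l.map g).map (gen Γ)).prod = Multiplicative.ofAdd ((l : Multiset _).count x) := by
    intro l x
    induction l with
    | nil => simp
    | cons y l ih =>
      rw [List.map_cons, List.map_cons, List.prod_cons, map_mul, ih, ← Multiset.cons_coe]
      by_cases h : y = x
      · rw [h, count_gen_self, ← ofAdd_add, add_comm, Multiset.count_cons_self]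
      · rw [count_gen_of_ne (hinj.ne h), one_mul, Multiset.count_cons_of_ne (Ne.symm h)]
  ext x
  have := count_eq_of_commute hN (hne x)
    ((hσN F).trans ((congrArg Subtype.val hFG).trans (hσN G).symm)) hcomm
  rw [hcount, hcount, Multiset.coe_toList, Multiset.coe_toList] at this
  exact Multiplicative.ofAdd.injective this

theorem isAdmissible : IsAdmissible (RightAngledArtinMonoid Γ) :=
  ⟨isRightLCM fun _ _ _ => not_adj_trans hN, isCoreFactorable hN, isCapClosed hN, N, hN,
    isFreelyGeneratedByIrreducibles hN⟩

end Scale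

end RightAngledArtinMonoid
end LCMSemigroup

theorem mainTheorem9 {V : Type*} [Countable V] (Γ : SimpleGraph V) :
    LCMSemigroup.IsAdmissible (LCMSemigroup.RightAngledArtinMonoid Γ) ↔
      ∃ N : LCMSemigroup.RightAngledArtinMonoid Γ →* ℕ+, LCMSemigroup.IsGeneralisedScale N := by
  refine ⟨?_, ?_⟩
  · rintro ⟨-, -, -, N, hN, -⟩
    exact ⟨N, hN⟩
  · rintro ⟨N, hN⟩
    exact LCMSemigroup.RightAngledArtinMonoid.isAdmissible hN
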